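/- Let $k$ be a field and let $G$ be an affine algebraic group over $k$, with coordinate ring $k[G]$ (a finitely generated commutative Hopf algebra over $k$); for example, $G$ may be a semisimple algebraic group over an algebraically closed field of positive characteristic. Let $I \subseteq k[G]$ be the augmentation ideal, i.e. the maximal ideal of the identity element, and let $$\bar U = \{\mu \in k[G]^* : \mu(I^{n+1}) = 0 \text{ for some } n \ge 0\}$$ be the hyperalgebra of $G$, with the convolution product dual to the comultiplication of $k[G]$, the comultiplication $\Delta : \bar U \to \bar U \otimes \bar U$ dual to the multiplication of $k[G]$, and the degree filtration $\bar U_n = \{\mu \in k[G]^* : \mu(I^{n+1}) = 0\}$, $n \ge 0$. Identify $\bar U \otimes \bar U$ with the hyperalgebra of $G \times G$, so that its elements are linear functionals on $k[G\times G] = k[G] \otimes k[G]$, with $(\mu\otimes\nu)(a \otimes b) = \mu(a)\nu(b)$. Let $I_\Delta \subseteq k[G \times G]$ be the ideal of the diagonal $\{(g,g)\} \subseteq G \times G$. Then for every $n \geq 0$ $$\{\mu \in \bar U \otimes \bar U : \mu(I_\Delta^{n+1}) = 0\} \;=\; \Delta\bar U \cdot (\bar U_n \otimes 1) \;=\; (\bar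 U_n \otimes 1)\cdot \Delta \bar U ,$$ where the product of two subspaces means the linear span of the products of their elements. Moreover, denoting this common subspace by $F_n$, the $F_n$ form a multiplicative filtration of the algebra $\bar U \otimes \bar U$: $F_n \subseteq F_{n+1}$, $\bigcup_n F_n = \bar U \otimes \bar U$, $1 \in F_0$ and $F_m F_n \subseteq F_{m+n}$ for all $m, n \ge 0$. -/

import Mathlib

open scoped TensorProduct

namespace Hyperalgebra

noncomputable section

section Basic

variable (k A : Type*) [Field k] [CommRing A] [Bialgebra k A]

/-- The augmentation ideal of `k[G] = A`: the maximal ideal of the identity element of `G`. -/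
def augIdeal : Ideal A := RingHom.ker (Bialgebra.counitAlgHom k A)

/-- The distributions on `G` at the identity of order at most `n`: the linear functionals on
`k[G] = A` vanishing on the `(n+1)`-st power of the augmentation ideal. -/
def distLE (n : ℕ) : Submodule k (WithConv (A →ₗ[k] k)) where
  carrier := {μ | ∀ f ∈ augIdeal k A ^ (n + 1), μ f = 0}
  add_mem' := by
    intro μ ν hμ hν f hf
    change μ f + ν f = 0
    rw [hμ f hf, hν f hf, add_zero]
  zero_mem' := fun _ _ => rfl
  smul_mem' := by
    intro c μ hμ f hf
    change c • μ f = 0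
    rw [hμ f hf, smul_zero]

variable {k A}

theorem mem_distLE {n : ℕ} {μ : WithConv (A →ₗ[k] k)} :
    μ ∈ distLE k A n ↔ ∀ f ∈ augIdeal k A ^ (n + 1), μ f = 0 := Iff.rfl

variable (k A) in
theorem distLE_mono : Monotone (distLE k A) := fun _ _ h _ hμ f hf =>
  hμ f (Ideal.pow_le_pow_right (Nat.succ_le_succ h) hf)

theorem counit_tensor (x : A ⊗[k] A) :
    Bialgebra.counitAlgHom k (A ⊗[k] A) x =
      Bialgebra.counitAlgHom k A (Algebra.TensorProduct.lmul' k x) := by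
  induction x with
  | zero => simp
  | add x y hx hy => simp only [map_add, hx, hy]
  | tmul a b => simp [mul_comm]

theorem mul_mem_augIdeal {n : ℕ} {x : A ⊗[k] A} (hx : x ∈ augIdeal k (A ⊗[k] A) ^ n) :
    Algebra.TensorProduct.lmul' k x ∈ augIdeal k A ^ n := by
  have h : augIdeal k (A ⊗[k] A) ≤
      (augIdeal k A).comap (Algebra.TensorProduct.lmul' k : A ⊗[k] A →ₐ[k] A) := by
    intro y hy
    simp only [augIdeal, Ideal.mem_comap, RingHom.mem_ker] at hy ⊢
    rw [← counit_tensor, hy]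
  exact Ideal.le_comap_pow _ n (Ideal.pow_right_mono h n hx)

theorem comul_mem_augIdeal {n : ℕ} {a : A} (ha : a ∈ augIdeal k A ^ n) :
    Bialgebra.comulAlgHom k A a ∈ augIdeal k (A ⊗[k] A) ^ n := by
  have h : augIdeal k A ≤
      (augIdeal k (A ⊗[k] A)).comap (Bialgebra.comulAlgHom k A) := by
    intro y hy
    simp only [augIdeal, Ideal.mem_comap, RingHom.mem_ker] at hy ⊢
    have key : ∀ x : A ⊗[k] A, Bialgebra.counitAlgHom k (A ⊗[k] A) x =
        Bialgebra.counitAlgHom k A (TensorProduct.lid k A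
          ((Coalgebra.counit (R := k) (A := A)).rTensor A x)) := by
      intro x
      induction x with
      | zero => simp
      | add x y hx hy => simp only [map_add, hx, hy]
      | tmul a b => simp [mul_comm]
    rw [key, Bialgebra.comulAlgHom_apply, Coalgebra.rTensor_counit_comul]
    simpa using hy
  exact Ideal.le_comap_pow _ n (Ideal.pow_right_mono h n ha)

variable (k A) in
theorem augIdeal_tensor : augIdeal k (A ⊗[k] A) =
    (augIdeal k A).map (Algebra.TensorProduct.includeLeft : A →ₐ[k] A ⊗[k] A) ⊔
      (augIdeal k A).map (Algebra.TensorProduct.includeRight : A →ₐ[k] A ⊗[k] A) := by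
  have hs : Function.Surjective (Bialgebra.counitAlgHom k A) := fun c =>
    ⟨algebraMap k A c, by simp⟩
  rw [augIdeal, augIdeal, ← Algebra.TensorProduct.map_ker _ _ hs hs]
  ext x
  simp only [RingHom.mem_ker, Bialgebra.TensorProduct.counitAlgHom_def]
  simp

theorem tensor_apply_left {n : ℕ} {μ : WithConv (A →ₗ[k] k)} (hμ : μ ∈ distLE k A n)
    (ν : WithConv (A →ₗ[k] k)) {y : A ⊗[k] A}
    (hy : y ∈ (augIdeal k A ^ (n + 1)).map
      (Algebra.TensorProduct.includeLeft : A →ₐ[k] A ⊗[k] A)) :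
    TensorProduct.dualDistrib k A A (μ.ofConv ⊗ₜ ν.ofConv) y = 0 := by
  obtain ⟨t, rfl⟩ := (Ideal.map_includeLeft_eq (R := k) (B := A) (augIdeal k A ^ (n + 1))).le hy
  clear hy
  induction t with
  | zero => simp
  | add s t hs ht => rw [map_add, map_add, hs, ht, add_zero]
  | tmul a b =>
    have : μ.ofConv (a : A) = 0 := hμ _ a.2
    simp [this]

theorem tensor_apply_right {n : ℕ} {ν : WithConv (A →ₗ[k] k)} (hν : ν ∈ distLE k A n)
    (μ : WithConv (A →ₗ[k] k)) {y : A ⊗[k] A}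
    (hy : y ∈ (augIdeal k A ^ (n + 1)).map
      (Algebra.TensorProduct.includeRight : A →ₐ[k] A ⊗[k] A)) :
    TensorProduct.dualDistrib k A A (μ.ofConv ⊗ₜ ν.ofConv) y = 0 := by
  obtain ⟨t, rfl⟩ := (Ideal.map_includeRight_eq (R := k) (A := A) (augIdeal k A ^ (n + 1))).le hy
  clear hy
  induction t with
  | zero => simp
  | add s t hs ht => rw [map_add, map_add, hs, ht, add_zero]
  | tmul a b =>
    have : ν.ofConv (b : A) = 0 := hν _ b.2
    simp [this]

theorem tensor_apply_eq_zero {m n : ℕ} {μ ν : WithConv (A →ₗ[k] k)}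
    (hμ : μ ∈ distLE k A m) (hν : ν ∈ distLE k A n) {x : A ⊗[k] A}
    (hx : x ∈ augIdeal k (A ⊗[k] A) ^ ((m + 1) + (n + 1))) :
    TensorProduct.dualDistrib k A A (μ.ofConv ⊗ₜ ν.ofConv) x = 0 := by
  rw [augIdeal_tensor] at hx
  replace hx := Ideal.sup_pow_add_le_pow_sup_pow hx
  rw [← Ideal.map_pow, ← Ideal.map_pow] at hx
  obtain ⟨y, hy, z, hz, rfl⟩ := Submodule.mem_sup.1 hx
  rw [map_add, tensor_apply_left hμ ν hy, tensor_apply_right hν μ hz, add_zero]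

theorem convMul_apply_eq (μ ν : WithConv (A →ₗ[k] k)) (a : A) :
    (μ * ν) a =
      TensorProduct.dualDistrib k A A (μ.ofConv ⊗ₜ ν.ofConv) (Bialgebra.comulAlgHom k A a) := by
  rw [LinearMap.convMul_apply, Bialgebra.comulAlgHom_apply]
  generalize (Coalgebra.comul (R := k) a : A ⊗[k] A) = x
  induction x with
  | zero => simp
  | add x y hx hy => simp only [map_add, hx, hy]
  | tmul a b => simp

variable (k A) in
/-- The hyperalgebra (algebra of distributions at the identity) of the affine group `G` with
coordinate algebra `k[G] = A`: all linear functionals on `A` that vanish on some power of the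
augmentation ideal, with the convolution product `(μ * ν)(f) = (μ ⊗ ν)(Δ f)`. -/
def hyperalgebra : Subalgebra k (WithConv (A →ₗ[k] k)) where
  carrier := {μ | ∃ n, μ ∈ distLE k A n}
  add_mem' := by
    rintro μ ν ⟨m, hm⟩ ⟨n, hn⟩
    exact ⟨max m n, Submodule.add_mem _ (distLE_mono k A (le_max_left m n) hm)
      (distLE_mono k A (le_max_right m n) hn)⟩
  mul_mem' := by
    rintro μ ν ⟨m, hm⟩ ⟨n, hn⟩
    refine ⟨m + n + 1, fun f hf => ?_⟩
    rw [convMul_apply_eq]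
    refine tensor_apply_eq_zero hm hn (comul_mem_augIdeal ?_)
    rwa [show (m + 1) + (n + 1) = m + n + 1 + 1 by omega]
  algebraMap_mem' := by
    intro c
    refine ⟨0, fun f hf => ?_⟩
    have : Coalgebra.counit (R := k) f = 0 := by
      simpa [augIdeal, RingHom.mem_ker] using hf
    simp [this]

variable (k A) in
/-- The degree filtration of the hyperalgebra: distributions of order at most `n`. -/
def degreeFiltration (n : ℕ) : Submodule k (hyperalgebra k A) :=
  (distLE k A n).comap (hyperalgebra k A).val.toLinearMap

variable (k A) in
/-- The underlying linear functional of an element of the hyperalgebra. -/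
def toDual : hyperalgebra k A →ₗ[k] Module.Dual k A :=
  (WithConv.linearEquiv k (A →ₗ[k] k)).toLinearMap ∘ₗ (hyperalgebra k A).val.toLinearMap

theorem toDual_injective : Function.Injective (toDual k A) :=
  (WithConv.linearEquiv k (A →ₗ[k] k)).injective.comp Subtype.val_injective

/-- The pushforward of distributions along the diagonal embedding `G → G × G`, `g ↦ (g, g)`,
dual to the multiplication `k[G × G] = A ⊗ A → A`. -/
def diagPush : hyperalgebra k A →ₐ[k] hyperalgebra k (A ⊗[k] A) where
  toFun X := ⟨WithConv.toConv (X.1.ofConv ∘ₗ LinearMap.mul' k A), by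
    obtain ⟨n, hn⟩ := X.2
    exact ⟨n, fun f hf => hn _ (mul_mem_augIdeal hf)⟩⟩
  map_zero' := rfl
  map_add' _ _ := rfl
  map_one' := by
    refine Subtype.ext (WithConv.ofConv_injective ?_)
    ext a b
    simp [mul_comm]
  map_mul' X Y := by
    refine Subtype.ext (WithConv.ofConv_injective ?_)
    exact LinearMap.convMul_comp_coalgHom_distrib X.1 Y.1 (Bialgebra.mulCoalgHom k A)
  commutes' c := by
    refine Subtype.ext (WithConv.ofConv_injective ?_)
    ext a b
    simp [mul_comm]

theorem dualDistrib_mem (μ ν : hyperalgebra k A) :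
    WithConv.toConv (TensorProduct.dualDistrib k A A (toDual k A μ ⊗ₜ toDual k A ν)) ∈
      hyperalgebra k (A ⊗[k] A) := by
  obtain ⟨m, hm⟩ := μ.2
  obtain ⟨n, hn⟩ := ν.2
  exact ⟨m + 1 + n, fun f hf => tensor_apply_eq_zero hm hn hf⟩

variable (k A) in
/-- The linear map sending `μ ⊗ ν` to the functional `a ⊗ b ↦ μ a * ν b` on `A ⊗ A`. -/
def tensorToDual :
    hyperalgebra k A ⊗[k] hyperalgebra k A →ₗ[k] Module.Dual k (A ⊗[k] A) :=
  TensorProduct.dualDistrib k A A ∘ₗ TensorProduct.map (toDual k A) (toDual k A)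

theorem tensorToDual_mem (t : hyperalgebra k A ⊗[k] hyperalgebra k A) :
    WithConv.toConv (tensorToDual k A t) ∈ hyperalgebra k (A ⊗[k] A) := by
  induction t with
  | zero => rw [map_zero]; exact Subalgebra.zero_mem _
  | add x y hx hy => rw [map_add]; exact Subalgebra.add_mem _ hx hy
  | tmul μ ν => exact dualDistrib_mem μ ν

variable (k A) in
/-- The canonical algebra homomorphism from `Ū ⊗ Ū` to the hyperalgebra of `G × G`, where `Ū`
is the hyperalgebra of `G`; it sends `μ ⊗ ν` to the functional `a ⊗ b ↦ μ a * ν b`. -/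
def tensorHom : hyperalgebra k A ⊗[k] hyperalgebra k A →ₐ[k] hyperalgebra k (A ⊗[k] A) :=
  Algebra.TensorProduct.algHomOfLinearMapTensorProduct
    { toFun := fun t => ⟨WithConv.toConv (tensorToDual k A t), tensorToDual_mem t⟩
      map_add' := fun x y => Subtype.ext (by simp)
      map_smul' := fun c x => Subtype.ext (by simp) }
    (by
      intro a₁ a₂ b₁ b₂
      refine Subtype.ext (WithConv.ofConv_injective ?_)
      have h2 := TensorProduct.map_convMul_map (f := a₁.1) (h := a₂.1) (g := b₁.1) (k := b₂.1)
      have h3 := LinearMap.algHom_comp_convMul_distrib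
        (Algebra.TensorProduct.lid k k).toAlgHom
        (WithConv.toConv (TensorProduct.map a₁.1.ofConv b₁.1.ofConv))
        (WithConv.toConv (TensorProduct.map a₂.1.ofConv b₂.1.ofConv))
      rw [h2] at h3
      exact h3)
    (by
      refine Subtype.ext (WithConv.ofConv_injective ?_)
      ext a b
      simp [tensorToDual, toDual, mul_comm])

theorem dualDistrib_injective : Function.Injective (TensorProduct.dualDistrib k A A) := by
  rw [injective_iff_map_eq_zero]
  classical
  intro t ht
  let b := Module.Basis.ofVectorSpace k (Module.Dual k A)
  obtain ⟨c, rfl⟩ := (TensorProduct.equivFinsuppOfBasisRight b).symm.surjective t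
  rw [TensorProduct.equivFinsuppOfBasisRight_symm_apply] at ht
  suffices h : c = 0 by simp [h]
  ext i a
  have h2 : c.sum (fun i m => m a • b i) = 0 := by
    ext y
    have := LinearMap.congr_fun ht (a ⊗ₜ y)
    simpa [Finsupp.sum, LinearMap.sum_apply] using this
  have h3 := linearIndependent_iff'.1 b.linearIndependent c.support (fun i => c i a) h2 i
  by_cases hi : i ∈ c.support
  · exact h3 hi
  · simp [Finsupp.notMem_support_iff.1 hi]

theorem tensorHom_injective : Function.Injective (tensorHom k A) := by
  have : Module.Free k (hyperalgebra k A) :=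
    have : Module.Free k (LinearMap.range (toDual k A)) :=
      @Module.Free.of_divisionRing k _ _ (Submodule.addCommGroup _) _
    Module.Free.of_equiv (LinearEquiv.ofInjective (toDual k A) toDual_injective).symm
  have h : Function.Injective (tensorToDual k A) :=
    dualDistrib_injective.comp
      (TensorProduct.map_injective_of_flat_flat _ _ toDual_injective toDual_injective)
  intro x y hxy
  exact h (WithConv.toConv_injective (Subtype.ext_iff.1 hxy))

variable (k A) in
theorem exists_finite_complement [Algebra.FiniteType k A] (n : ℕ) :
    ∃ V : Submodule k A, V.FG ∧ V ⊔ (augIdeal k A ^ n).restrictScalars k = ⊤ := by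
  have : IsNoetherianRing A := Algebra.FiniteType.isNoetherianRing k A
  induction n with
  | zero => exact ⟨⊥, Submodule.fg_bot, by simp⟩
  | succ n ih =>
    obtain ⟨V, hV, hVn⟩ := ih
    obtain ⟨S, hS⟩ := IsNoetherian.noetherian (augIdeal k A ^ n)
    refine ⟨V ⊔ Submodule.span k (S : Set A), hV.sup ⟨S, rfl⟩, ?_⟩
    rw [eq_top_iff, ← hVn]
    refine sup_le (le_sup_left.trans le_sup_left) ?_
    rw [sup_assoc]
    refine le_trans ?_ le_sup_right
    intro x hx
    have hx : x ∈ Submodule.span A (S : Set A) := by rw [hS]; exact hx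
    clear * - hx hS
    induction hx using Submodule.span_induction with
    | mem x hx => exact Submodule.mem_sup_left (Submodule.subset_span hx)
    | zero => exact Submodule.zero_mem _
    | add x y _ _ hx hy => exact Submodule.add_mem _ hx hy
    | smul a x hxS hx =>
      have hc : a - algebraMap k A (Bialgebra.counitAlgHom k A a) ∈ augIdeal k A := by
        simp [augIdeal, RingHom.mem_ker]
      have hx' : x ∈ augIdeal k A ^ n := hS.le hxS
      have he : a • x = Bialgebra.counitAlgHom k A a • x +
          (a - algebraMap k A (Bialgebra.counitAlgHom k A a)) * x := by
        rw [smul_eq_mul, Algebra.smul_def]; ring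
      rw [he]
      refine Submodule.add_mem _ (Submodule.smul_mem _ _ hx) (Submodule.mem_sup_right ?_)
      change _ ∈ augIdeal k A ^ (n + 1)
      rw [pow_succ']
      exact Ideal.mul_mem_mul hc hx'

instance finite_quotient [Algebra.FiniteType k A] (n : ℕ) :
    Module.Finite k (A ⧸ augIdeal k A ^ n) := by
  obtain ⟨V, hV, h⟩ := exists_finite_complement k A n
  have : Module.Finite k V := Module.Finite.iff_fg.2 hV
  refine Module.Finite.of_surjective
    ((Ideal.Quotient.mkₐ k (augIdeal k A ^ n)).toLinearMap ∘ₗ V.subtype) ?_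
  intro y
  obtain ⟨x, rfl⟩ := Ideal.Quotient.mk_surjective y
  obtain ⟨v, hv, w, hw, rfl⟩ := Submodule.mem_sup.1 (h.ge (Submodule.mem_top (x := x)))
  refine ⟨⟨v, hv⟩, ?_⟩
  change Ideal.Quotient.mk _ v = Ideal.Quotient.mk _ (v + w)
  rw [map_add, Ideal.Quotient.eq_zero_iff_mem.2 hw, add_zero]

theorem tensorHom_surjective [Algebra.FiniteType k A] :
    Function.Surjective (tensorHom k A) := by
  rintro ⟨l, N, hl⟩
  let Q := A ⧸ augIdeal k A ^ (N + 1)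
  let π : A →ₐ[k] Q := Ideal.Quotient.mkₐ k _
  have hπ : Function.Surjective π := Ideal.Quotient.mk_surjective
  let p := Algebra.TensorProduct.map π π
  have hp : Function.Surjective p := Algebra.TensorProduct.map_surjective π π hπ hπ
  have hker : LinearMap.ker p.toLinearMap ≤ LinearMap.ker l.ofConv := by
    intro x hx
    replace hx : x ∈ RingHom.ker p := hx
    rw [Algebra.TensorProduct.map_ker π π hπ hπ] at hx
    refine hl x ?_
    have hπk : RingHom.ker π = augIdeal k A ^ (N + 1) := Ideal.Quotient.mkₐ_ker k _
    rw [hπk, Ideal.map_pow, Ideal.map_pow] at hx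
    have hle := (augIdeal_tensor k A).ge
    exact sup_le (Ideal.pow_right_mono (le_sup_left.trans hle) _)
      (Ideal.pow_right_mono (le_sup_right.trans hle) _) hx
  obtain ⟨l', hl'⟩ : ∃ l' : Module.Dual k (Q ⊗[k] Q), l' ∘ₗ p.toLinearMap = l.ofConv := by
    obtain ⟨s, hs⟩ := p.toLinearMap.exists_rightInverse_of_surjective (LinearMap.range_eq_top.2 hp)
    refine ⟨l.ofConv ∘ₗ s, LinearMap.ext fun x => ?_⟩
    have h1 : s (p x) - x ∈ LinearMap.ker p.toLinearMap := by
      have := LinearMap.congr_fun hs (p x)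
      simp only [LinearMap.comp_apply, LinearMap.id_apply, AlgHom.toLinearMap_apply] at this
      simp [this]
    have h2 := hker h1
    rw [LinearMap.mem_ker, map_sub, sub_eq_zero] at h2
    exact h2
  obtain ⟨t, rfl⟩ := (TensorProduct.dualDistribEquiv k Q Q).surjective l'
  have hd : ∀ φ : Module.Dual k Q, WithConv.toConv (φ ∘ₗ π.toLinearMap) ∈ hyperalgebra k A := by
    intro φ
    refine ⟨N, fun f hf => ?_⟩
    change φ (Ideal.Quotient.mk _ f) = 0
    rw [Ideal.Quotient.eq_zero_iff_mem.2 hf, map_zero]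
  let D : Module.Dual k Q →ₗ[k] hyperalgebra k A :=
    { toFun := fun φ => ⟨WithConv.toConv (φ ∘ₗ π.toLinearMap), hd φ⟩
      map_add' := fun _ _ => rfl
      map_smul' := fun _ _ => rfl }
  refine ⟨TensorProduct.map D D t, Subtype.ext (WithConv.ofConv_injective ?_)⟩
  change tensorToDual k A (TensorProduct.map D D t) = l.ofConv
  rw [← hl']
  clear hl'
  induction t with
  | zero => simp
  | add x y hx hy => simp only [map_add, hx, hy, LinearMap.add_comp]
  | tmul φ ψ =>
    ext a b
    simp [tensorToDual, toDual, D, p, TensorProduct.dualDistribEquivOfBasis]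
    rfl

variable (k A) in
/-- The identification of `Ū ⊗ Ū` with the hyperalgebra of `G × G`. -/
def tensorEquiv [Algebra.FiniteType k A] :
    hyperalgebra k A ⊗[k] hyperalgebra k A ≃ₐ[k] hyperalgebra k (A ⊗[k] A) :=
  AlgEquiv.ofBijective (tensorHom k A) ⟨tensorHom_injective, tensorHom_surjective⟩

variable (k A) in
/-- The comultiplication `Δ : Ū → Ū ⊗ Ū` of the hyperalgebra of `G`, dual to the multiplication
of `k[G]`. -/
def hyperComul [Algebra.FiniteType k A] :
    hyperalgebra k A →ₐ[k] hyperalgebra k A ⊗[k] hyperalgebra k A :=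
  (tensorEquiv k A).symm.toAlgHom.comp diagPush

variable (k A) in
/-- The ideal of the diagonal of `G × G` in `k[G × G] = A ⊗ A`. -/
def diagonalIdeal : Ideal (A ⊗[k] A) :=
  RingHom.ker (Algebra.TensorProduct.lmul' k : A ⊗[k] A →ₐ[k] A)

variable (k A) in
/-- The elements of `Ū ⊗ Ū` which, regarded as linear functionals on `k[G × G]`, annihilate the
`(n+1)-st` power of the ideal of the diagonal. -/
def diagonalFiltration (n : ℕ) : Submodule k (hyperalgebra k A ⊗[k] hyperalgebra k A) where
  carrier := {t | ∀ f ∈ diagonalIdeal k A ^ (n + 1), tensorToDual k A t f = 0}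
  add_mem' := by
    intro s t hs ht f hf
    rw [map_add, LinearMap.add_apply, hs f hf, ht f hf, add_zero]
  zero_mem' := by
    intro f _
    rw [map_zero, LinearMap.zero_apply]
  smul_mem' := by
    intro c t ht f hf
    rw [map_smul, LinearMap.smul_apply, ht f hf, smul_zero]

end Basic

end

end Hyperalgebra

/-!
The automorphism `σ : (x, y) ↦ (xy, x)` of the scheme `G × G` fixes the identity, and the preimage
of the diagonal under it is `G × {e}`. Pushing distributions forward along `σ` sends `X ⊗ Y` to
`ΔX · (Y ⊗ 1)` (`tensorToDual_hyperComul_mul`). Hence the elements of `Ū ⊗ Ū` annihilating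
`I_Δ ^ (n + 1)` are the pushforwards of those annihilating `k[G] ⊗ I ^ (n + 1)`. By linear algebra
over a field (`mem_range_lTensor_subtype_of_dualDistrib`) the latter form `Ū ⊗ Ū_n`, so the former
form `ΔŪ · (Ū_n ⊗ 1)`. The opposite order of the factors comes in the same way from the automorphism
`(x, y) ↦ (xy, y)`, for which the preimage of the diagonal is `{e} × G`. On coordinate rings the
two automorphisms are `shearLeft` and `shearRight`; their inverses `unshearLeft` and `unshearRight`
are built with the antipode. Of the two identities expressing that these maps are inverse to each
other, only `unshear ∘ shear = id` is needed.

Multiplicativity follows by combining both decompositions with the sharp inclusion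
`Ū_m Ū_n ⊆ Ū_{m+n}` of the degree filtration (`convMul_mem_distLE`). The filtration is exhaustive
because the identity lies on the diagonal, that is, `I_Δ` is contained in the augmentation ideal of
`k[G × G]`.
-/

namespace Hyperalgebra

noncomputable section

open Algebra.TensorProduct (includeLeft includeRight)

/-! ### Sharp bound for powers of a sum of ideals -/

/-- The exponent `m + n + 1` is one better than what `Ideal.sup_pow_add_le_pow_sup_pow` gives; this
is what makes the degree filtration multiplicative without a shift. -/
theorem sup_pow_add_add_one_le {R : Type*} [CommSemiring R] (I J : Ideal R) (m n : ℕ) :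
    (I ⊔ J) ^ (m + n + 1) ≤ I ^ (m + 1) ⊔ J ^ (n + 1) := by
  rw [← Ideal.add_eq_sup, add_pow, Ideal.sum_eq_sup]
  refine Finset.sup_le fun i _ => ?_
  by_cases hi : m + 1 ≤ i
  · exact Ideal.mul_le_left.trans (Ideal.mul_le_left.trans
      ((Ideal.pow_le_pow_right hi).trans le_sup_left))
  · exact Ideal.mul_le_left.trans (Ideal.mul_le_right.trans
      ((Ideal.pow_le_pow_right (by omega)).trans le_sup_right))

/-! ### Tensors annihilated by functionals in one factor -/

section LinearAlgebra

variable {k M N A B : Type*} [CommSemiring k] [AddCommMonoid M] [Module k M] [AddCommMonoid N]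
  [Module k N] [AddCommMonoid A] [Module k A] [AddCommMonoid B] [Module k B]

/-- Let `M` and `N` map to the duals of `A` and `B`, the first injectively, and let `W ⊆ N` contain
every element of `N` vanishing on `S ⊆ B`. Then an element of `M ⊗ N` vanishing on all `a ⊗ b` with
`b ∈ S` lies in `M ⊗ W`: its coefficients with respect to a basis of `M` lie in `W`. -/
theorem mem_range_lTensor_subtype_of_dualDistrib [Module.Free k M] {e : M →ₗ[k] Module.Dual k A}
    {e' : N →ₗ[k] Module.Dual k B} (he : Function.Injective e) {W : Submodule k N}
    {S : Set B}
    (hW : ∀ y, (∀ f ∈ S, e' y f = 0) → y ∈ W) {t : M ⊗[k] N}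
    (ht : ∀ a, ∀ b ∈ S, TensorProduct.dualDistrib k A B (TensorProduct.map e e' t) (a ⊗ₜ b) = 0) :
    t ∈ LinearMap.range (W.subtype.lTensor M) := by
  classical
  let b := Module.Free.chooseBasis k M
  obtain ⟨c, rfl⟩ := (TensorProduct.equivFinsuppOfBasisLeft b).symm.surjective t
  rw [TensorProduct.equivFinsuppOfBasisLeft_symm_apply] at ht ⊢
  refine Submodule.sum_mem _ fun i _ => ?_
  have hc : c i ∈ W := by
    refine hW _ fun f hf => ?_
    -- `d` collects the coordinates in the basis `b` of the contraction of the tensor with `f`.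
    let d : Module.Free.ChooseBasisIndex k M →₀ k :=
      c.mapRange (fun y => e' y f) (by simp)
    suffices h : b.repr.symm d = 0 by
      have := DFunLike.congr_fun ((LinearEquiv.map_eq_zero_iff _).1 h) i
      simpa [d] using this
    refine he (LinearMap.ext fun a => ?_)
    rw [map_zero, LinearMap.zero_apply, ← ht a f hf]
    rw [Module.Basis.repr_symm_apply, Finsupp.linearCombination_apply,
      show d = c.mapRange _ _ from rfl,
      Finsupp.sum_mapRange_index (fun i => zero_smul k (b i))]
    simp [Finsupp.sum, LinearMap.sum_apply, mul_comm]
  exact ⟨b i ⊗ₜ ⟨c i, hc⟩, by simp⟩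

/-- The mirror image of `mem_range_lTensor_subtype_of_dualDistrib`. -/
theorem mem_range_rTensor_subtype_of_dualDistrib [Module.Free k N] {e : M →ₗ[k] Module.Dual k A}
    {e' : N →ₗ[k] Module.Dual k B} (he : Function.Injective e') {W : Submodule k M}
    {S : Set A}
    (hW : ∀ y, (∀ f ∈ S, e y f = 0) → y ∈ W) {t : M ⊗[k] N}
    (ht : ∀ a ∈ S, ∀ b, TensorProduct.dualDistrib k A B (TensorProduct.map e e' t) (a ⊗ₜ b) = 0) :
    t ∈ LinearMap.range (W.subtype.rTensor N) := by
  classical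
  let b := Module.Free.chooseBasis k N
  obtain ⟨c, rfl⟩ := (TensorProduct.equivFinsuppOfBasisRight b).symm.surjective t
  rw [TensorProduct.equivFinsuppOfBasisRight_symm_apply] at ht ⊢
  refine Submodule.sum_mem _ fun i _ => ?_
  have hc : c i ∈ W := by
    refine hW _ fun f hf => ?_
    -- `d` collects the coordinates in the basis `b` of the contraction of the tensor with `f`.
    let d : Module.Free.ChooseBasisIndex k N →₀ k :=
      c.mapRange (fun y => e y f) (by simp)
    suffices h : b.repr.symm d = 0 by
      have := DFunLike.congr_fun ((LinearEquiv.map_eq_zero_iff _).1 h) i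
      simpa [d] using this
    refine he (LinearMap.ext fun a => ?_)
    rw [map_zero, LinearMap.zero_apply, ← ht f hf a]
    rw [Module.Basis.repr_symm_apply, Finsupp.linearCombination_apply,
      show d = c.mapRange _ _ from rfl,
      Finsupp.sum_mapRange_index (fun i => zero_smul k (b i))]
    simp [Finsupp.sum, LinearMap.sum_apply]
  exact ⟨⟨c i, hc⟩ ⊗ₜ b i, by simp⟩

end LinearAlgebra

/-! ### The degree filtration -/

section Bialgebra

variable {k A : Type*} [Field k] [CommRing A] [Bialgebra k A]

/-- The order of distributions is subadditive under convolution: comultiplication maps the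
augmentation ideal `I` into `I ⊗ A + A ⊗ I`. -/
theorem convMul_mem_distLE {m n : ℕ} {μ ν : WithConv (A →ₗ[k] k)}
    (hμ : μ ∈ distLE k A m) (hν : ν ∈ distLE k A n) : μ * ν ∈ distLE k A (m + n) := by
  intro f hf
  rw [convMul_apply_eq]
  have hx := comul_mem_augIdeal hf
  rw [augIdeal_tensor] at hx
  replace hx := sup_pow_add_add_one_le _ _ _ _ hx
  rw [← Ideal.map_pow, ← Ideal.map_pow] at hx
  obtain ⟨y, hy, z, hz, h⟩ := Submodule.mem_sup.1 hx
  rw [← h, map_add, tensor_apply_left hμ ν hy, tensor_apply_right hν μ hz, add_zero]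

variable (k A) in
theorem degreeFiltration_mul_le (m n : ℕ) :
    degreeFiltration k A m * degreeFiltration k A n ≤ degreeFiltration k A (m + n) :=
  Submodule.mul_le.2 fun _ hX _ hY => convMul_mem_distLE hX hY

/-- Freeness is transported from the range of `toDual`, a subspace of the dual of `A`. -/
instance : Module.Free k (hyperalgebra k A) :=
  have : Module.Free k (LinearMap.range (toDual k A)) :=
    @Module.Free.of_divisionRing k _ _ (Submodule.addCommGroup _) _
  Module.Free.of_equiv (LinearEquiv.ofInjective (toDual k A) toDual_injective).symm

theorem tensorToDual_tmul (X Y : hyperalgebra k A) (a b : A) :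
    tensorToDual k A (X ⊗ₜ Y) (a ⊗ₜ b) = toDual k A X a * toDual k A Y b := by
  simp [tensorToDual]

theorem mem_range_lTensor_degreeFiltration {n : ℕ} {s : hyperalgebra k A ⊗[k] hyperalgebra k A}
    (hs : ∀ a, ∀ b ∈ augIdeal k A ^ (n + 1), tensorToDual k A s (a ⊗ₜ b) = 0) :
    s ∈ LinearMap.range ((degreeFiltration k A n).subtype.lTensor (hyperalgebra k A)) :=
  mem_range_lTensor_subtype_of_dualDistrib (S := (augIdeal k A ^ (n + 1) : Ideal A))
    (W := degreeFiltration k A n) (e := toDual k A) (e' := toDual k A) toDual_injective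
    (fun _ hY => hY) hs

theorem mem_range_rTensor_degreeFiltration {n : ℕ} {s : hyperalgebra k A ⊗[k] hyperalgebra k A}
    (hs : ∀ a ∈ augIdeal k A ^ (n + 1), ∀ b, tensorToDual k A s (a ⊗ₜ b) = 0) :
    s ∈ LinearMap.range ((degreeFiltration k A n).subtype.rTensor (hyperalgebra k A)) :=
  mem_range_rTensor_subtype_of_dualDistrib (S := (augIdeal k A ^ (n + 1) : Ideal A))
    (W := degreeFiltration k A n) (e := toDual k A) (e' := toDual k A) toDual_injective
    (fun _ hY => hY) hs

/-! ### The shear maps and the ideal of the diagonal -/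

variable (k A) in
/-- The pullback along `G × G → G × G`, `(x, y) ↦ (xy, x)`: the algebra homomorphism
`a ⊗ b ↦ Δ(a) (b ⊗ 1)`. -/
def shearLeft : A ⊗[k] A →ₐ[k] A ⊗[k] A :=
  Algebra.TensorProduct.lift (Bialgebra.comulAlgHom k A) includeLeft fun _ _ => Commute.all _ _

variable (k A) in
/-- The pullback along `G × G → G × G`, `(x, y) ↦ (xy, y)`: the algebra homomorphism
`a ⊗ b ↦ Δ(a) (1 ⊗ b)`. -/
def shearRight : A ⊗[k] A →ₐ[k] A ⊗[k] A :=
  Algebra.TensorProduct.lift (Bialgebra.comulAlgHom k A) includeRight fun _ _ => Commute.all _ _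

/-- Under `(x, y) ↦ (xy, x)` the subgroup `y = e` maps into the diagonal. -/
theorem shearLeft_diagonalIdeal_le :
    diagonalIdeal k A ≤ ((augIdeal k A).map (includeRight : A →ₐ[k] A ⊗[k] A)).comap
      (shearLeft k A) := by
  have hs : Function.Surjective (Bialgebra.counitAlgHom k A) := fun c =>
    ⟨algebraMap k A c, by simp⟩
  intro f hf
  rw [Ideal.mem_comap, augIdeal, ← Algebra.TensorProduct.lTensor_ker _ hs, RingHom.mem_ker]
  have h : (Algebra.TensorProduct.map (AlgHom.id k A) (Bialgebra.counitAlgHom k A)).comp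
      (shearLeft k A) = includeLeft.comp (Algebra.TensorProduct.lmul' k) := by
    ext a
    · have : Algebra.TensorProduct.map (AlgHom.id k A) (Bialgebra.counitAlgHom k A)
          (Coalgebra.comul a) = a ⊗ₜ 1 := Coalgebra.lTensor_counit_comul a
      simp [shearLeft, this]
    · simp [shearLeft]
  have := DFunLike.congr_fun h f
  simp only [AlgHom.comp_apply] at this
  rw [this, show Algebra.TensorProduct.lmul' k f = 0 from hf, map_zero]

/-- Under `(x, y) ↦ (xy, y)` the subgroup `x = e` maps into the diagonal. -/
theorem shearRight_diagonalIdeal_le :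
    diagonalIdeal k A ≤ ((augIdeal k A).map (includeLeft : A →ₐ[k] A ⊗[k] A)).comap
      (shearRight k A) := by
  have hs : Function.Surjective (Bialgebra.counitAlgHom k A) := fun c =>
    ⟨algebraMap k A c, by simp⟩
  intro f hf
  rw [Ideal.mem_comap, augIdeal, ← Algebra.TensorProduct.rTensor_ker _ hs, RingHom.mem_ker]
  have h : (Algebra.TensorProduct.map (Bialgebra.counitAlgHom k A) (AlgHom.id k A)).comp
      (shearRight k A) = includeRight.comp (Algebra.TensorProduct.lmul' k) := by
    ext a
    · have : Algebra.TensorProduct.map (Bialgebra.counitAlgHom k A) (AlgHom.id k A)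
          (Coalgebra.comul a) = 1 ⊗ₜ a := Coalgebra.rTensor_counit_comul a
      simp [shearRight, this]
    · simp [shearRight]
  have := DFunLike.congr_fun h f
  simp only [AlgHom.comp_apply] at this
  rw [this, show Algebra.TensorProduct.lmul' k f = 0 from hf, map_zero]

theorem tensorToDual_tmul_shearLeft_eq_zero {n : ℕ} (X : hyperalgebra k A) {Y : hyperalgebra k A}
    (hY : Y ∈ degreeFiltration k A n) {f : A ⊗[k] A} (hf : f ∈ diagonalIdeal k A ^ (n + 1)) :
    tensorToDual k A (X ⊗ₜ Y) (shearLeft k A f) = 0 := by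
  have h := Ideal.le_comap_pow _ _ (Ideal.pow_right_mono shearLeft_diagonalIdeal_le _ hf)
  rw [Ideal.mem_comap, ← Ideal.map_pow] at h
  exact tensor_apply_right hY X.1 h

theorem tensorToDual_tmul_shearRight_eq_zero {n : ℕ} {Y : hyperalgebra k A}
    (hY : Y ∈ degreeFiltration k A n) (X : hyperalgebra k A) {f : A ⊗[k] A}
    (hf : f ∈ diagonalIdeal k A ^ (n + 1)) :
    tensorToDual k A (Y ⊗ₜ X) (shearRight k A f) = 0 := by
  have h := Ideal.le_comap_pow _ _ (Ideal.pow_right_mono shearRight_diagonalIdeal_le _ hf)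
  rw [Ideal.mem_comap, ← Ideal.map_pow] at h
  exact tensor_apply_left hY X.1 h

theorem diagonalIdeal_le_augIdeal : diagonalIdeal k A ≤ augIdeal k (A ⊗[k] A) := by
  intro f hf
  rw [augIdeal, RingHom.mem_ker, counit_tensor,
    show Algebra.TensorProduct.lmul' k f = 0 from hf, map_zero]

/-! ### Elementary properties of the diagonal filtration -/

variable (k A) in
theorem diagonalFiltration_mono : Monotone (diagonalFiltration k A) := fun _ _ h _ ht f hf =>
  ht f (Ideal.pow_le_pow_right (Nat.succ_le_succ h) hf)

variable (k A) in
theorem iSup_diagonalFiltration : ⨆ n, diagonalFiltration k A n = ⊤ := by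
  refine eq_top_iff.2 fun t _ => ?_
  obtain ⟨n, hn⟩ := tensorToDual_mem t
  exact Submodule.mem_iSup_of_mem n fun f hf =>
    hn f (Ideal.pow_right_mono diagonalIdeal_le_augIdeal _ hf)

variable (k A) in
theorem one_mem_diagonalFiltration : 1 ∈ diagonalFiltration k A 0 := by
  intro f hf
  rw [zero_add, pow_one] at hf
  have h : tensorToDual k A 1 f = Bialgebra.counitAlgHom k (A ⊗[k] A) f := by
    exact congrArg (fun X => toDual k (A ⊗[k] A) X f) (map_one (tensorHom k A))
  rw [h]
  exact diagonalIdeal_le_augIdeal hf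

theorem tensorToDual_injective : Function.Injective (tensorToDual k A) := fun _ _ h =>
  tensorHom_injective (Subtype.ext (WithConv.ofConv_injective h))

/-! ### Products with `Δ Ū` as pullbacks along the shear maps -/

section FiniteType

variable [Algebra.FiniteType k A]

theorem tensorHom_hyperComul (X : hyperalgebra k A) :
    tensorHom k A (hyperComul k A X) = diagPush X :=
  (tensorEquiv k A).apply_symm_apply (diagPush X)

/-- The functional `ΔX · (Y ⊗ 1)` is the pushforward of `X ⊗ Y` along `(x, y) ↦ (xy, x)`. -/
theorem tensorToDual_hyperComul_mul (X Y : hyperalgebra k A) (f : A ⊗[k] A) :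
    tensorToDual k A (hyperComul k A X * Y ⊗ₜ 1) f =
      tensorToDual k A (X ⊗ₜ Y) (shearLeft k A f) := by
  change (tensorHom k A (hyperComul k A X * Y ⊗ₜ 1)).1 f = _
  rw [map_mul, tensorHom_hyperComul]
  change ((diagPush X).1 * (tensorHom k A (Y ⊗ₜ 1)).1) f = _
  rw [convMul_apply_eq]
  induction f with
  | zero => simp only [map_zero]
  | add x y hx hy => simp only [map_add, hx, hy]
  | tmul a b =>
    -- The comultiplications of `a` and `b` may be replaced by arbitrary tensors `x` and `y`, for
    -- which both sides are bilinear.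
    have key : ∀ x y : A ⊗[k] A,
        TensorProduct.dualDistrib k (A ⊗[k] A) (A ⊗[k] A)
          ((diagPush X).1.ofConv ⊗ₜ (tensorHom k A (Y ⊗ₜ 1)).1.ofConv)
          (TensorProduct.AlgebraTensorModule.tensorTensorTensorComm k k k k A A A A (x ⊗ₜ y)) =
        tensorToDual k A (X ⊗ₜ Y) (x * (TensorProduct.rid k A
          ((Coalgebra.counit (R := k) (A := A)).lTensor A y) ⊗ₜ 1)) := by
      intro x y
      induction x with
      | zero => simp only [TensorProduct.zero_tmul, map_zero, zero_mul]
      | add x x' hx hx' => simp only [TensorProduct.add_tmul, map_add, add_mul, hx, hx']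
      | tmul p r =>
        induction y with
        | zero => simp only [TensorProduct.tmul_zero, TensorProduct.zero_tmul, map_zero, mul_zero]
        | add y y' hy hy' =>
          simp only [TensorProduct.tmul_add, TensorProduct.add_tmul, map_add, mul_add, hy, hy']
        | tmul q s =>
          have h1 : (diagPush X).1.ofConv (p ⊗ₜ q) = toDual k A X (p * q) := rfl
          have h2 : (tensorHom k A (Y ⊗ₜ 1)).1.ofConv (r ⊗ₜ s) =
            toDual k A Y r * Coalgebra.counit (R := k) s := rfl
          rw [TensorProduct.AlgebraTensorModule.tensorTensorTensorComm_tmul,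
            TensorProduct.dualDistrib_apply, h1, h2, LinearMap.lTensor_tmul,
            TensorProduct.rid_tmul, Algebra.TensorProduct.tmul_mul_tmul, tensorToDual_tmul,
            mul_smul_comm, mul_one, map_smul, smul_eq_mul]
          ring
    rw [Bialgebra.comulAlgHom_apply, TensorProduct.comul_tmul, key, Coalgebra.lTensor_counit_comul,
      TensorProduct.rid_tmul, one_smul]
    simp [shearLeft]

/-- The functional `(Y ⊗ 1) · ΔX` is the pushforward of `Y ⊗ X` along `(x, y) ↦ (xy, y)`. -/
theorem tensorToDual_mul_hyperComul (X Y : hyperalgebra k A) (f : A ⊗[k] A) :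
    tensorToDual k A (Y ⊗ₜ 1 * hyperComul k A X) f =
      tensorToDual k A (Y ⊗ₜ X) (shearRight k A f) := by
  change (tensorHom k A (Y ⊗ₜ 1 * hyperComul k A X)).1 f = _
  rw [map_mul, tensorHom_hyperComul]
  change ((tensorHom k A (Y ⊗ₜ 1)).1 * (diagPush X).1) f = _
  rw [convMul_apply_eq]
  induction f with
  | zero => simp only [map_zero]
  | add x y hx hy => simp only [map_add, hx, hy]
  | tmul a b =>
    -- The comultiplications of `a` and `b` may be replaced by arbitrary tensors `x` and `y`, for
    -- which both sides are bilinear.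
    have key : ∀ x y : A ⊗[k] A,
        TensorProduct.dualDistrib k (A ⊗[k] A) (A ⊗[k] A)
          ((tensorHom k A (Y ⊗ₜ 1)).1.ofConv ⊗ₜ (diagPush X).1.ofConv)
          (TensorProduct.AlgebraTensorModule.tensorTensorTensorComm k k k k A A A A (x ⊗ₜ y)) =
        tensorToDual k A (Y ⊗ₜ X) (x * (1 ⊗ₜ TensorProduct.lid k A
          ((Coalgebra.counit (R := k) (A := A)).rTensor A y))) := by
      intro x y
      induction x with
      | zero => simp only [TensorProduct.zero_tmul, map_zero, zero_mul]
      | add x x' hx hx' => simp only [TensorProduct.add_tmul, map_add, add_mul, hx, hx']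
      | tmul p r =>
        induction y with
        | zero => simp only [TensorProduct.tmul_zero, map_zero, mul_zero]
        | add y y' hy hy' =>
          simp only [TensorProduct.tmul_add, map_add, mul_add, hy, hy']
        | tmul q s =>
          have h1 : (diagPush X).1.ofConv (r ⊗ₜ s) = toDual k A X (r * s) := rfl
          have h2 : (tensorHom k A (Y ⊗ₜ 1)).1.ofConv (p ⊗ₜ q) =
            toDual k A Y p * Coalgebra.counit (R := k) q := rfl
          rw [TensorProduct.AlgebraTensorModule.tensorTensorTensorComm_tmul,
            TensorProduct.dualDistrib_apply, h1, h2, LinearMap.rTensor_tmul,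
            TensorProduct.lid_tmul, Algebra.TensorProduct.tmul_mul_tmul, tensorToDual_tmul,
            mul_smul_comm, mul_one, map_smul, smul_eq_mul]
          ring
    rw [Bialgebra.comulAlgHom_apply, TensorProduct.comul_tmul, key, Coalgebra.rTensor_counit_comul,
      TensorProduct.lid_tmul, one_smul]
    simp [shearRight]

/-- Distributions on `G × G` at the identity can be pushed forward along any endomorphism of the
scheme `G × G` that fixes the identity. -/
theorem exists_tensorToDual_eq_comp {θ : A ⊗[k] A →ₐ[k] A ⊗[k] A}
    (hθ : (Bialgebra.counitAlgHom k (A ⊗[k] A)).comp θ = Bialgebra.counitAlgHom k (A ⊗[k] A))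
    (t : hyperalgebra k A ⊗[k] hyperalgebra k A) :
    ∃ s, ∀ f, tensorToDual k A s f = tensorToDual k A t (θ f) := by
  obtain ⟨n, hn⟩ := tensorToDual_mem t
  have hle : augIdeal k (A ⊗[k] A) ≤ (augIdeal k (A ⊗[k] A)).comap θ := by
    intro f hf
    have := DFunLike.congr_fun hθ f
    rw [Ideal.mem_comap, augIdeal, RingHom.mem_ker]
    exact this.trans hf
  obtain ⟨s, hs⟩ := tensorHom_surjective (k := k) (A := A)
    ⟨WithConv.toConv (tensorToDual k A t ∘ₗ θ.toLinearMap), n, fun f hf =>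
      hn _ (Ideal.le_comap_pow _ _ (Ideal.pow_right_mono hle _ hf))⟩
  exact ⟨s, fun f => congrArg (fun X => toDual k (A ⊗[k] A) X f) hs⟩

end FiniteType

end Bialgebra

/-! ### The inverses of the shear maps -/

section HopfAlgebra

variable {k A : Type*} [Field k] [CommRing A] [HopfAlgebra k A]

variable (k A) in
/-- The pullback along `(u, v) ↦ (v, v⁻¹u)`, the inverse of `(x, y) ↦ (xy, x)`. -/
def unshearLeft : A ⊗[k] A →ₐ[k] A ⊗[k] A :=
  Algebra.TensorProduct.lift includeRight
    (((Algebra.TensorProduct.map (AlgHom.id k A) (HopfAlgebra.antipodeAlgHom k A)).comp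
      (Algebra.TensorProduct.comm k A A).toAlgHom).comp (Bialgebra.comulAlgHom k A))
    fun _ _ => Commute.all _ _

variable (k A) in
/-- The pullback along `(u, v) ↦ (uv⁻¹, v)`, the inverse of `(x, y) ↦ (xy, y)`. -/
def unshearRight : A ⊗[k] A →ₐ[k] A ⊗[k] A :=
  Algebra.TensorProduct.lift
    ((Algebra.TensorProduct.map (AlgHom.id k A) (HopfAlgebra.antipodeAlgHom k A)).comp
      (Bialgebra.comulAlgHom k A))
    includeRight fun _ _ => Commute.all _ _

theorem unshearRight_comp_shearRight :
    (unshearRight k A).comp (shearRight k A) = AlgHom.id k (A ⊗[k] A) := by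
  ext a
  · -- On `a ⊗ 1` the composite is `a₍₁₎ ⊗ S(a₍₂₎) a₍₃₎`, which is rewritten by coassociativity
    -- so that the antipode axiom applies.
    have h : ∀ x : A ⊗[k] A, unshearRight k A x =
        (LinearMap.mul' k A ∘ₗ (HopfAlgebra.antipode k).rTensor A).lTensor A
          (TensorProduct.assoc k A A A (Coalgebra.comul.rTensor A x)) := by
      intro x
      induction x with
      | zero => simp
      | add x y hx hy => simp only [map_add, hx, hy]
      | tmul a b =>
        simp only [unshearRight, Algebra.TensorProduct.lift_tmul, AlgHom.comp_apply,
          Bialgebra.comulAlgHom_apply, LinearMap.rTensor_tmul]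
        generalize (Coalgebra.comul (R := k) a : A ⊗[k] A) = y
        induction y with
        | zero => simp
        | add x y hx hy => simp only [map_add, add_mul, TensorProduct.add_tmul, hx, hy]
        | tmul c d => simp
    have hθ : shearRight k A (a ⊗ₜ 1) = Coalgebra.comul a := by
      rw [shearRight, Algebra.TensorProduct.lift_tmul, map_one, mul_one]; rfl
    change unshearRight k A (shearRight k A (a ⊗ₜ 1)) = a ⊗ₜ 1
    rw [hθ, h, Coalgebra.coassoc_apply, ← LinearMap.comp_apply, ← LinearMap.lTensor_comp,
      LinearMap.comp_assoc, HopfAlgebra.mul_antipode_rTensor_comul, LinearMap.lTensor_comp,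
      LinearMap.comp_apply, Coalgebra.lTensor_counit_comul]
    simp
  · simp [shearRight, unshearRight]

theorem unshearLeft_comp_shearLeft :
    (unshearLeft k A).comp (shearLeft k A) = AlgHom.id k (A ⊗[k] A) := by
  ext a
  · -- On `a ⊗ 1` the composite is `a₍₃₎ ⊗ a₍₁₎ S(a₍₂₎)`, which is rewritten by coassociativity
    -- so that the antipode axiom applies.
    have h : ∀ x : A ⊗[k] A, unshearLeft k A x =
        TensorProduct.comm k A A
          ((LinearMap.mul' k A ∘ₗ (HopfAlgebra.antipode k).lTensor A).rTensor A
          ((TensorProduct.assoc k A A A).symm (Coalgebra.comul.lTensor A x))) := by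
      intro x
      induction x with
      | zero => simp
      | add x y hx hy => simp only [map_add, hx, hy]
      | tmul a b =>
        simp only [unshearLeft, Algebra.TensorProduct.lift_tmul, AlgHom.comp_apply,
          Bialgebra.comulAlgHom_apply, LinearMap.lTensor_tmul]
        generalize (Coalgebra.comul (R := k) b : A ⊗[k] A) = y
        induction y with
        | zero => simp
        | add x y hx hy => simp only [map_add, mul_add, TensorProduct.tmul_add, hx, hy]
        | tmul c d => simp
    have hθ : shearLeft k A (a ⊗ₜ 1) = Coalgebra.comul a := by
      rw [shearLeft, Algebra.TensorProduct.lift_tmul, map_one, mul_one]; rfl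
    change unshearLeft k A (shearLeft k A (a ⊗ₜ 1)) = a ⊗ₜ 1
    rw [hθ, h, Coalgebra.coassoc_symm_apply, ← LinearMap.comp_apply (LinearMap.rTensor A _),
      ← LinearMap.rTensor_comp,
      LinearMap.comp_assoc, HopfAlgebra.mul_antipode_lTensor_comul, LinearMap.rTensor_comp,
      LinearMap.comp_apply, Coalgebra.rTensor_counit_comul]
    simp
  · simp [shearLeft, unshearLeft]

/-- The second component of `(u, v) ↦ (v, v⁻¹u)` is constant on the diagonal. -/
theorem lmul'_unshearLeft_one_tmul (a : A) :
    Algebra.TensorProduct.lmul' k (unshearLeft k A (1 ⊗ₜ a)) =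
      algebraMap k A (Coalgebra.counit a) := by
  rw [← HopfAlgebra.mul_antipode_rTensor_comul_apply, unshearLeft, Algebra.TensorProduct.lift_tmul,
    map_one, one_mul, AlgHom.comp_apply, Bialgebra.comulAlgHom_apply]
  generalize (Coalgebra.comul (R := k) a : A ⊗[k] A) = y
  induction y with
  | zero => simp
  | add x y hx hy => simp only [map_add, hx, hy]
  | tmul c d => simp [mul_comm]

/-- The first component of `(u, v) ↦ (uv⁻¹, v)` is constant on the diagonal. -/
theorem lmul'_unshearRight_tmul_one (a : A) :
    Algebra.TensorProduct.lmul' k (unshearRight k A (a ⊗ₜ 1)) =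
      algebraMap k A (Coalgebra.counit a) := by
  rw [← HopfAlgebra.mul_antipode_lTensor_comul_apply, unshearRight,
    Algebra.TensorProduct.lift_tmul, map_one, mul_one]
  rfl

theorem counit_comp_unshearLeft :
    (Bialgebra.counitAlgHom k (A ⊗[k] A)).comp (unshearLeft k A) =
      Bialgebra.counitAlgHom k (A ⊗[k] A) := by
  ext a
  · simp [unshearLeft]
  · change Bialgebra.counitAlgHom k (A ⊗[k] A) (unshearLeft k A (1 ⊗ₜ a)) =
      Bialgebra.counitAlgHom k (A ⊗[k] A) (1 ⊗ₜ a)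
    rw [counit_tensor, lmul'_unshearLeft_one_tmul]
    simp

theorem counit_comp_unshearRight :
    (Bialgebra.counitAlgHom k (A ⊗[k] A)).comp (unshearRight k A) =
      Bialgebra.counitAlgHom k (A ⊗[k] A) := by
  ext a
  · change Bialgebra.counitAlgHom k (A ⊗[k] A) (unshearRight k A (a ⊗ₜ 1)) =
      Bialgebra.counitAlgHom k (A ⊗[k] A) (a ⊗ₜ 1)
    rw [counit_tensor, lmul'_unshearRight_tmul_one]
    simp
  · simp [unshearRight]

theorem unshearLeft_tmul_mem {n : ℕ} (a : A) {b : A} (hb : b ∈ augIdeal k A ^ n) :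
    unshearLeft k A (a ⊗ₜ b) ∈ diagonalIdeal k A ^ n := by
  let ψ : A →ₐ[k] A ⊗[k] A := (unshearLeft k A).comp includeRight
  have hle : augIdeal k A ≤ (diagonalIdeal k A).comap ψ := by
    intro f hf
    have hf : Coalgebra.counit (R := k) f = 0 := hf
    change Algebra.TensorProduct.lmul' k (unshearLeft k A (1 ⊗ₜ f)) = 0
    rw [lmul'_unshearLeft_one_tmul, hf, map_zero]
  have h : unshearLeft k A (a ⊗ₜ b) = unshearLeft k A (a ⊗ₜ 1) * ψ b := by simp [ψ, ← map_mul]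
  rw [h]
  exact Ideal.mul_mem_left _ _ (Ideal.le_comap_pow ψ n (Ideal.pow_right_mono hle n hb))

theorem unshearRight_tmul_mem {n : ℕ} {a : A} (ha : a ∈ augIdeal k A ^ n) (b : A) :
    unshearRight k A (a ⊗ₜ b) ∈ diagonalIdeal k A ^ n := by
  let ψ : A →ₐ[k] A ⊗[k] A := (unshearRight k A).comp includeLeft
  have hle : augIdeal k A ≤ (diagonalIdeal k A).comap ψ := by
    intro f hf
    have hf : Coalgebra.counit (R := k) f = 0 := hf
    change Algebra.TensorProduct.lmul' k (unshearRight k A (f ⊗ₜ 1)) = 0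
    rw [lmul'_unshearRight_tmul_one, hf, map_zero]
  have h : unshearRight k A (a ⊗ₜ b) = unshearRight k A (1 ⊗ₜ b) * ψ a := by simp [ψ, ← map_mul]
  rw [h]
  exact Ideal.mul_mem_left _ _ (Ideal.le_comap_pow ψ n (Ideal.pow_right_mono hle n ha))

/-! ### The two product decompositions -/

section FiniteType

variable [Algebra.FiniteType k A]

variable (k A) in
theorem diagonalFiltration_eq_range_mul (n : ℕ) :
    diagonalFiltration k A n =
      LinearMap.range (hyperComul k A).toLinearMap *
        (degreeFiltration k A n).map (includeLeft : hyperalgebra k A →ₐ[k]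
          hyperalgebra k A ⊗[k] hyperalgebra k A).toLinearMap := by
  refine le_antisymm (fun t ht => ?_) (Submodule.mul_le.2 ?_)
  · -- The pushforward `s` of `t` along the inverse shear lies in `Ū ⊗ Ū_n`.
    obtain ⟨s, hs⟩ := exists_tensorToDual_eq_comp (counit_comp_unshearLeft (k := k) (A := A)) t
    obtain ⟨u, hu⟩ := mem_range_lTensor_degreeFiltration (n := n) (s := s) fun a b hb => by
      rw [hs]
      exact ht _ (unshearLeft_tmul_mem a hb)
    have hst : ∀ f, tensorToDual k A s (shearLeft k A f) = tensorToDual k A t f := fun f => by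
      rw [hs, ← AlgHom.comp_apply, unshearLeft_comp_shearLeft, AlgHom.id_apply]
    rw [← hu] at hst
    clear hs hu ht
    -- Pushing back along the shear turns it into a sum of products.
    obtain ⟨w, hw, hwu⟩ : ∃ w ∈ LinearMap.range (hyperComul k A).toLinearMap *
        (degreeFiltration k A n).map (includeLeft : hyperalgebra k A →ₐ[k]
          hyperalgebra k A ⊗[k] hyperalgebra k A).toLinearMap,
        ∀ f, tensorToDual k A w f = tensorToDual k A
          ((degreeFiltration k A n).subtype.lTensor (hyperalgebra k A) u) (shearLeft k A f) := by
      clear hst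
      induction u with
      | zero => exact ⟨0, Submodule.zero_mem _, fun f => by
          rw [LinearMap.map_zero, LinearMap.map_zero, LinearMap.map_zero]; rfl⟩
      | add x y hx hy =>
        obtain ⟨w, hw, hx⟩ := hx
        obtain ⟨v, hv, hy⟩ := hy
        exact ⟨w + v, Submodule.add_mem _ hw hv, fun f => by
          simp only [map_add, LinearMap.add_apply, hx, hy]⟩
      | tmul X Y =>
        exact ⟨hyperComul k A X * Y.1 ⊗ₜ 1, Submodule.mul_mem_mul ⟨X, rfl⟩ ⟨Y, Y.2, rfl⟩,
          fun f => tensorToDual_hyperComul_mul X Y.1 f⟩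
    rwa [← tensorToDual_injective (LinearMap.ext fun f => (hwu f).trans (hst f))]
  · rintro _ ⟨X, rfl⟩ _ ⟨Y, hY, rfl⟩ f hf
    exact (tensorToDual_hyperComul_mul X Y f).trans (tensorToDual_tmul_shearLeft_eq_zero X hY hf)

variable (k A) in
theorem diagonalFiltration_eq_mul_range (n : ℕ) :
    diagonalFiltration k A n =
      (degreeFiltration k A n).map (includeLeft : hyperalgebra k A →ₐ[k]
          hyperalgebra k A ⊗[k] hyperalgebra k A).toLinearMap *
        LinearMap.range (hyperComul k A).toLinearMap := by
  refine le_antisymm (fun t ht => ?_) (Submodule.mul_le.2 ?_)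
  · -- The pushforward `s` of `t` along the inverse shear lies in `Ū_n ⊗ Ū`.
    obtain ⟨s, hs⟩ := exists_tensorToDual_eq_comp (counit_comp_unshearRight (k := k) (A := A)) t
    obtain ⟨u, hu⟩ := mem_range_rTensor_degreeFiltration (n := n) (s := s) fun a ha b => by
      rw [hs]
      exact ht _ (unshearRight_tmul_mem ha b)
    have hst : ∀ f, tensorToDual k A s (shearRight k A f) = tensorToDual k A t f := fun f => by
      rw [hs, ← AlgHom.comp_apply, unshearRight_comp_shearRight, AlgHom.id_apply]
    rw [← hu] at hst
    clear hs hu ht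
    -- Pushing back along the shear turns it into a sum of products.
    obtain ⟨w, hw, hwu⟩ : ∃ w ∈ (degreeFiltration k A n).map (includeLeft : hyperalgebra k A →ₐ[k]
          hyperalgebra k A ⊗[k] hyperalgebra k A).toLinearMap *
        LinearMap.range (hyperComul k A).toLinearMap,
        ∀ f, tensorToDual k A w f = tensorToDual k A
          ((degreeFiltration k A n).subtype.rTensor (hyperalgebra k A) u) (shearRight k A f) := by
      clear hst
      induction u with
      | zero => exact ⟨0, Submodule.zero_mem _, fun f => by
          rw [LinearMap.map_zero, LinearMap.map_zero, LinearMap.map_zero]; rfl⟩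
      | add x y hx hy =>
        obtain ⟨w, hw, hx⟩ := hx
        obtain ⟨v, hv, hy⟩ := hy
        exact ⟨w + v, Submodule.add_mem _ hw hv, fun f => by
          simp only [map_add, LinearMap.add_apply, hx, hy]⟩
      | tmul Y X =>
        exact ⟨Y.1 ⊗ₜ 1 * hyperComul k A X, Submodule.mul_mem_mul ⟨Y, Y.2, rfl⟩ ⟨X, rfl⟩,
          fun f => tensorToDual_mul_hyperComul X Y.1 f⟩
    rwa [← tensorToDual_injective (LinearMap.ext fun f => (hwu f).trans (hst f))]
  · rintro _ ⟨Y, hY, rfl⟩ _ ⟨X, rfl⟩ f hf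
    exact (tensorToDual_mul_hyperComul X Y f).trans (tensorToDual_tmul_shearRight_eq_zero hY X hf)

variable (k A) in
/-- With `D = ΔŪ` and `U_n = Ū_n ⊗ 1`, both decompositions together give
`(U_m D)(D U_n) ⊆ U_m D U_n = U_m U_n D ⊆ U_{m+n} D`. -/
theorem diagonalFiltration_mul_le (m n : ℕ) :
    diagonalFiltration k A m * diagonalFiltration k A n ≤ diagonalFiltration k A (m + n) := by
  have hD : LinearMap.range (hyperComul k A).toLinearMap *
      LinearMap.range (hyperComul k A).toLinearMap ≤
        LinearMap.range (hyperComul k A).toLinearMap :=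
    Submodule.mul_le.2 fun _ ⟨X, hX⟩ _ ⟨Y, hY⟩ => ⟨X * Y, by
      rw [← hX, ← hY]; exact map_mul (hyperComul k A) X Y⟩
  let U := fun n => (degreeFiltration k A n).map (includeLeft : hyperalgebra k A →ₐ[k]
    hyperalgebra k A ⊗[k] hyperalgebra k A).toLinearMap
  let D := LinearMap.range (hyperComul k A).toLinearMap
  calc diagonalFiltration k A m * diagonalFiltration k A n
      = U m * (D * D) * U n := by
        rw [diagonalFiltration_eq_mul_range k A m, diagonalFiltration_eq_range_mul k A n]
        change U m * D * (D * U n) = _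
        rw [← mul_assoc, mul_assoc (U m) D D]
    _ ≤ U m * D * U n := by gcongr
    _ = U m * U n * D := by
        rw [mul_assoc, ← diagonalFiltration_eq_range_mul k A n,
          diagonalFiltration_eq_mul_range k A n, mul_assoc]
    _ ≤ U (m + n) * D := by
        have hU : U m * U n ≤ U (m + n) := by
          rw [← Submodule.map_mul]
          exact Submodule.map_mono (degreeFiltration_mul_le k A m n)
        gcongr
    _ = diagonalFiltration k A (m + n) := (diagonalFiltration_eq_mul_range k A _).symm

end FiniteType

end HopfAlgebra

end

end Hyperalgebra

theorem mainTheorem5 {k A : Type*} [Field k] [CommRing A] [HopfAlgebra k A]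
    [Algebra.FiniteType k A] :
    (∀ n : ℕ,
      Hyperalgebra.diagonalFiltration k A n =
          LinearMap.range (Hyperalgebra.hyperComul k A).toLinearMap *
            (Hyperalgebra.degreeFiltration k A n).map
              (Algebra.TensorProduct.includeLeft : Hyperalgebra.hyperalgebra k A →ₐ[k]
                Hyperalgebra.hyperalgebra k A ⊗[k] Hyperalgebra.hyperalgebra k A).toLinearMap ∧
      Hyperalgebra.diagonalFiltration k A n =
          (Hyperalgebra.degreeFiltration k A n).map
              (Algebra.TensorProduct.includeLeft : Hyperalgebra.hyperalgebra k A →ₐ[k]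
                Hyperalgebra.hyperalgebra k A ⊗[k] Hyperalgebra.hyperalgebra k A).toLinearMap *
            LinearMap.range (Hyperalgebra.hyperComul k A).toLinearMap) ∧
    Monotone (Hyperalgebra.diagonalFiltration k A) ∧
    (⨆ n, Hyperalgebra.diagonalFiltration k A n) = ⊤ ∧
    1 ∈ Hyperalgebra.diagonalFiltration k A 0 ∧
    ∀ m n : ℕ,
      Hyperalgebra.diagonalFiltration k A m * Hyperalgebra.diagonalFiltration k A n ≤
        Hyperalgebra.diagonalFiltration k A (m + n) :=
  ⟨fun n => ⟨Hyperalgebra.diagonalFiltration_eq_range_mul k A n,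
      Hyperalgebra.diagonalFiltration_eq_mul_range k A n⟩,
    Hyperalgebra.diagonalFiltration_mono k A, Hyperalgebra.iSup_diagonalFiltration k A,
    Hyperalgebra.one_mem_diagonalFiltration k A, Hyperalgebra.diagonalFiltration_mul_le k A⟩
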